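/- Let $0<\gamma\le\infty$ and let $\psi:[0,\gamma)\to[0,\infty)$ be a non-zero increasing (i.e. non-decreasing) concave function, continuous on $(0,\gamma)$, with $\psi(0)=0$. Let $L_0(0,\gamma)$ be the space of (classes modulo a.e. equality of) real-valued Lebesgue measurable functions on $(0,\gamma)$, ordered pointwise a.e. For $f\in L_0(0,\gamma)$ let $f^*(s)=\inf\{r\ge 0: m(\{x\in(0,\gamma):|f(x)|>r\})\le s\}$, $s\ge 0$, be its decreasing rearrangement ($m$ is Lebesgue measure, $\inf\emptyset=\infty$), and put $$\|f\|_{M_\psi}=\sup_{0<t<\gamma}\frac1{\psi(t)}\int_0^t f^*(s)\,ds .$$ Let $M_\psi(0,\gamma)=\{f\in L_0(0,\gamma):\|f\|_{M_\psi}<\infty\}$ be the Marcinkiewicz space, a Banach lattice with this norm and the a.e. order. Suppose that one of the following two conditions holds: (A) $\gamma=\infty$, $\ \liminf_{t\downarrow 0}\dfrac{\psi(2t)}{\psi(t)}>1$ and $\liminf_{t\to\infty}\dfrac{\psi(2t)}{\psi(t)}>1$; (B) $\gamma<\infty$ and $\liminf_{t\downarrow 0}\dfrac{\psi(2t)}{\psi(t)}>1$.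 Then the norm of the dual Banach lattice $M_\psi(0,\gamma)^*$ (ordered by $\varphi_1\le\varphi_2$ iff $\varphi_1(f)\le\varphi_2(f)$ for all $0\le f\in M_\psi(0,\gamma)$) is order continuous, i.e. $\|\varphi_\tau\|\to 0$ for every net $\varphi_\tau\downarrow 0$ (decreasing with infimum $0$) in $M_\psi(0,\gamma)^*$. -/

import Mathlib

open MeasureTheory Filter Topology Set
open scoped ENNReal NNReal

namespace Marc

section Rearrangement

variable {α : Type*} [MeasurableSpace α]

/-- The distribFunution function `d_{|f|}(r) = μ {x : |f x| > r}`. -/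
noncomputable def distribFun (μ : Measure α) (f : α → ℝ) (r : ℝ) : ℝ≥0∞ :=
  μ {x | r < |f x|}

/-- The decreasing rearrangement `f^*(s) = inf {r ≥ 0 : d_{|f|}(r) ≤ s}`, for `s ≥ 0`
(the infimum of the empty set is `∞`). -/
noncomputable def rearr (μ : Measure α) (f : α → ℝ) (s : ℝ) : ℝ≥0∞ :=
  ⨅ (r : ℝ≥0) (_ : distribFun μ f r ≤ ENNReal.ofReal s), (r : ℝ≥0∞)

/-- `∫_0^t f^*(s) ds`. -/
noncomputable def rearrInt (μ : Measure α) (f : α → ℝ) (t : ℝ) : ℝ≥0∞ :=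
  ∫⁻ s in Ioc 0 t, rearr μ f s

theorem distribFun_antitone (μ : Measure α) (f : α → ℝ) : Antitone (distribFun μ f) :=
  fun _ _ h => measure_mono fun _ hx => lt_of_le_of_lt h hx

theorem distribFun_mono {μ : Measure α} {f g : α → ℝ} (h : ∀ᵐ x ∂μ, |f x| ≤ |g x|) (r : ℝ) :
    distribFun μ f r ≤ distribFun μ g r := by
  refine measure_mono_ae ?_
  filter_upwards [h] with x hx hr
  exact lt_of_lt_of_le (show r < |f x| from hr) hx

theorem rearr_mono {μ : Measure α} {f g : α → ℝ} (h : ∀ᵐ x ∂μ, |f x| ≤ |g x|) (s : ℝ) :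
    rearr μ f s ≤ rearr μ g s :=
  le_iInf₂ fun r hr => iInf₂_le r ((distribFun_mono h r).trans hr)

theorem rearrInt_mono {μ : Measure α} {f g : α → ℝ} (h : ∀ᵐ x ∂μ, |f x| ≤ |g x|) (t : ℝ) :
    rearrInt μ f t ≤ rearrInt μ g t :=
  lintegral_mono fun s => rearr_mono h s

theorem rearr_antitone (μ : Measure α) (f : α → ℝ) : Antitone (rearr μ f) :=
  fun _ _ h => le_iInf₂ fun r hr => iInf₂_le r (hr.trans (ENNReal.ofReal_le_ofReal h))

theorem rearr_le_iff (μ : Measure α) (f : α → ℝ) (s : ℝ) (r : ℝ≥0) :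
    rearr μ f s ≤ r ↔ distribFun μ f r ≤ ENNReal.ofReal s := by
  refine ⟨fun h => ?_, fun h => iInf₂_le r h⟩
  have key : ∀ r' : ℝ≥0, r < r' → distribFun μ f r' ≤ ENNReal.ofReal s := by
    intro r' hr'
    have h1 : rearr μ f s < r' := h.trans_lt (by exact_mod_cast hr')
    unfold rearr at h1
    simp only [iInf_lt_iff] at h1
    obtain ⟨q, hq, hqr⟩ := h1
    have hqr' : (q : ℝ) ≤ r' := by exact_mod_cast hqr.le
    exact (distribFun_antitone μ f hqr').trans hq
  have hU : {x | (r : ℝ) < |f x|} = ⋃ n : ℕ, {x | (r : ℝ) + 1 / ((n : ℝ) + 1) < |f x|} := by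
    ext x
    simp only [mem_ofPred_eq, mem_iUnion]
    constructor
    · intro hx
      obtain ⟨n, hn⟩ := exists_nat_one_div_lt (sub_pos.2 hx)
      exact ⟨n, by linarith⟩
    · rintro ⟨n, hn⟩
      have : 0 < 1 / ((n : ℝ) + 1) := by positivity
      linarith
  have hmono : Monotone fun n : ℕ => {x | (r : ℝ) + 1 / ((n : ℝ) + 1) < |f x|} := by
    intro m n hmn x hx
    simp only [mem_ofPred_eq] at hx ⊢
    have : 1 / ((n : ℝ) + 1) ≤ 1 / ((m : ℝ) + 1) := Nat.one_div_le_one_div hmn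
    linarith
  unfold distribFun
  rw [hU, hmono.measure_iUnion]
  refine iSup_le fun n => ?_
  have h2 := key (r + 1 / ((n : ℝ≥0) + 1)) (lt_add_of_pos_right _ (by positivity))
  simpa [distribFun] using h2

theorem volume_ofReal_lt (a : ℝ≥0∞) :
    volume {r : ℝ | 0 < r ∧ ENNReal.ofReal r < a} = a := by
  induction a with
  | top =>
    have : {r : ℝ | 0 < r ∧ ENNReal.ofReal r < ⊤} = Ioi 0 := by ext; simp
    rw [this, Real.volume_Ioi]
  | coe a =>
    have : {r : ℝ | 0 < r ∧ ENNReal.ofReal r < a} = Ioo 0 (a : ℝ) := by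
      ext r
      simp only [mem_ofPred_eq, mem_Ioo]
      refine and_congr_right fun hr => ?_
      rw [← ENNReal.ofReal_coe_nnreal, ENNReal.ofReal_lt_ofReal_iff_of_nonneg hr.le]
    rw [this, Real.volume_Ioo, sub_zero, ENNReal.ofReal_coe_nnreal]

theorem rearrInt_eq (μ : Measure α) (f : α → ℝ) (t : ℝ) :
    rearrInt μ f t = ∫⁻ r in Ioi (0 : ℝ), min (distribFun μ f r) (ENNReal.ofReal t) := by
  have hm : MeasurableSet {p : ℝ × ℝ | ENNReal.ofReal p.1 < distribFun μ f p.2} :=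
    measurableSet_lt (ENNReal.measurable_ofReal.comp measurable_fst)
      ((distribFun_antitone μ f).measurable.comp measurable_snd)
  have h1 : ∀ s : ℝ, rearr μ f s = ∫⁻ r in Ioi (0 : ℝ),
      {p : ℝ × ℝ | ENNReal.ofReal p.1 < distribFun μ f p.2}.indicator 1 (s, r) := by
    intro s
    have hms : MeasurableSet {r : ℝ | ENNReal.ofReal s < distribFun μ f r} :=
      measurableSet_lt measurable_const (distribFun_antitone μ f).measurable
    have : (fun r : ℝ => {p : ℝ × ℝ | ENNReal.ofReal p.1 < distribFun μ f p.2}.indicator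
        (1 : ℝ × ℝ → ℝ≥0∞) (s, r)) =
        {r : ℝ | ENNReal.ofReal s < distribFun μ f r}.indicator 1 := by
      ext r; simp [indicator]
    rw [this, lintegral_indicator_one hms, Measure.restrict_apply hms]
    conv_lhs => rw [← volume_ofReal_lt (rearr μ f s)]
    congr 1
    ext r
    simp only [mem_ofPred_eq, mem_inter_iff, mem_Ioi]
    rw [and_comm]
    refine and_congr_left fun hr => ?_
    have := rearr_le_iff μ f s ⟨r, hr.le⟩
    rw [← not_le, ← not_le, not_iff_not, ← NNReal.coe_mk r hr.le, ENNReal.ofReal_coe_nnreal]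
    exact this
  unfold rearrInt
  simp_rw [h1]
  rw [lintegral_lintegral_swap]
  · refine lintegral_congr fun r => ?_
    have hms : MeasurableSet {s : ℝ | ENNReal.ofReal s < distribFun μ f r} :=
      measurableSet_lt ENNReal.measurable_ofReal measurable_const
    have : (fun s : ℝ => {p : ℝ × ℝ | ENNReal.ofReal p.1 < distribFun μ f p.2}.indicator
        (1 : ℝ × ℝ → ℝ≥0∞) (s, r)) =
        {s : ℝ | ENNReal.ofReal s < distribFun μ f r}.indicator 1 := by
      ext s; simp [indicator]
    rw [this, lintegral_indicator_one hms, restrict_Ioo_eq_restrict_Ioc.symm,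
      Measure.restrict_apply hms]
    conv_rhs => rw [← volume_ofReal_lt (min _ _)]
    congr 1
    ext s
    simp only [mem_ofPred_eq, mem_inter_iff, mem_Ioo, lt_min_iff]
    constructor
    · rintro ⟨h, h0, h2⟩
      exact ⟨h0, h, (ENNReal.ofReal_lt_ofReal_iff_of_nonneg h0.le).2 h2⟩
    · rintro ⟨h0, h, h2⟩
      exact ⟨h, h0, (ENNReal.ofReal_lt_ofReal_iff_of_nonneg h0.le).1 h2⟩
  · exact (measurable_one.indicator hm).aemeasurable

theorem lintegral_excess {μ : Measure α} {f : α → ℝ} (hf : AEMeasurable f μ) (c : ℝ) :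
    ∫⁻ x, ENNReal.ofReal (|f x| - c) ∂μ = ∫⁻ r in Ioi c, distribFun μ f r := by
  have h0 : ∀ x, ENNReal.ofReal (|f x| - c) = ENNReal.ofReal (max (|f x| - c) 0) := by
    intro x; rw [ENNReal.ofReal_max, ENNReal.ofReal_zero, max_eq_left zero_le]
  simp_rw [h0]
  have hm : AEMeasurable (fun x => max (|f x| - c) 0) μ :=
    (hf.norm.sub_const c).max aemeasurable_const
  have hn : 0 ≤ᵐ[μ] fun x => max (|f x| - c) 0 :=
    Eventually.of_forall fun x => le_max_right _ _
  rw [lintegral_eq_lintegral_meas_lt μ hn hm]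
  have h1 := (measurePreserving_add_left volume c).setLIntegral_comp_preimage
    (measurableSet_Ioi (a := c)) (distribFun_antitone μ f).measurable
  rw [← h1]
  have h2 : (fun x : ℝ => c + x) ⁻¹' Ioi c = Ioi 0 := by ext; simp
  rw [h2]
  refine setLIntegral_congr_fun measurableSet_Ioi fun r hr => ?_
  unfold distribFun
  congr 1
  ext x
  simp only [mem_ofPred_eq, lt_max_iff]
  constructor
  · rintro (h | h)
    · linarith
    · exact absurd h (not_lt.2 (le_of_lt hr))
  · intro h; left; linarith

theorem rearrInt_le {μ : Measure α} {f : α → ℝ} (hf : AEMeasurable f μ) (t : ℝ) {c : ℝ}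
    (hc : 0 ≤ c) :
    rearrInt μ f t ≤
      ENNReal.ofReal t * ENNReal.ofReal c + ∫⁻ x, ENNReal.ofReal (|f x| - c) ∂μ := by
  rw [rearrInt_eq, lintegral_excess hf, ← Ioc_union_Ioi_eq_Ioi hc]
  refine (lintegral_union_le _ _ _).trans (add_le_add ?_ ?_)
  · refine (lintegral_mono fun r => min_le_right _ _).trans ?_
    simp
  · exact lintegral_mono fun r => min_le_left _ _

theorem rearr_ne_top {μ : Measure α} {f : α → ℝ} {t : ℝ} (ht : 0 < t)
    (h : rearrInt μ f t ≠ ⊤) : rearr μ f t ≠ ⊤ := by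
  intro htop
  apply h
  rw [eq_top_iff]
  have h1 : ∫⁻ _ in Ioc 0 t, (⊤ : ℝ≥0∞) ≤ rearrInt μ f t :=
    setLIntegral_mono' measurableSet_Ioc fun s hs => by
      rw [← htop]; exact rearr_antitone μ f hs.2
  refine le_trans ?_ h1
  simp [ENNReal.top_mul, ht]

theorem le_rearrInt {μ : Measure α} {f : α → ℝ} (hf : AEMeasurable f μ) {t : ℝ}
    (h : rearr μ f t ≠ ⊤) :
    ENNReal.ofReal t * ENNReal.ofReal (rearr μ f t).toReal +
      ∫⁻ x, ENNReal.ofReal (|f x| - (rearr μ f t).toReal) ∂μ ≤ rearrInt μ f t := by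
  set c : ℝ≥0 := (rearr μ f t).toNNReal with hc
  have hcr : (rearr μ f t).toReal = c := rfl
  have hcc : rearr μ f t = c := (ENNReal.coe_toNNReal h).symm
  rw [hcr, rearrInt_eq, lintegral_excess hf, ← Ioc_union_Ioi_eq_Ioi c.2]
  rw [lintegral_union measurableSet_Ioi (by
    rw [Set.disjoint_left]; intro r h1 h2; exact absurd h1.2 (not_le.2 h2)),
    ← restrict_Ioo_eq_restrict_Ioc]
  refine add_le_add ?_ ?_
  · have h1 : ∫⁻ _ in Ioo 0 (c : ℝ), ENNReal.ofReal t ≤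
        ∫⁻ r in Ioo 0 (c : ℝ), min (distribFun μ f r) (ENNReal.ofReal t) := by
      refine setLIntegral_mono' measurableSet_Ioo fun r hr => le_min ?_ le_rfl
      by_contra hlt
      have h2 := (rearr_le_iff μ f t ⟨r, hr.1.le⟩).2 (not_le.1 hlt).le
      rw [hcc] at h2
      have h3 : c ≤ ⟨r, hr.1.le⟩ := ENNReal.coe_le_coe.1 h2
      exact absurd hr.2 (not_lt.2 h3)
    refine le_trans ?_ h1
    simp
  · refine setLIntegral_mono' measurableSet_Ioi fun r hr => le_min le_rfl ?_
    exact (distribFun_antitone μ f (le_of_lt hr)).trans ((rearr_le_iff μ f t c).1 hcc.le)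

theorem rearrInt_add_le {μ : Measure α} {f g : α → ℝ} (hf : AEMeasurable f μ)
    (hg : AEMeasurable g μ) {t : ℝ} (ht : 0 < t) :
    rearrInt μ (fun x => f x + g x) t ≤ rearrInt μ f t + rearrInt μ g t := by
  by_cases hF : rearrInt μ f t = ⊤
  · simp [hF]
  by_cases hG : rearrInt μ g t = ⊤
  · simp [hG]
  have h1 := le_rearrInt hf (rearr_ne_top ht hF)
  have h2 := le_rearrInt hg (rearr_ne_top ht hG)
  set a := (rearr μ f t).toReal
  set b := (rearr μ g t).toReal
  have ha : 0 ≤ a := ENNReal.toReal_nonneg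
  have hb : 0 ≤ b := ENNReal.toReal_nonneg
  refine (rearrInt_le (hf.add hg) t (add_nonneg ha hb)).trans
    (le_trans ?_ (add_le_add h1 h2))
  have h3 : ∫⁻ x, ENNReal.ofReal (|f x + g x| - (a + b)) ∂μ ≤
      ∫⁻ x, ENNReal.ofReal (|f x| - a) ∂μ + ∫⁻ x, ENNReal.ofReal (|g x| - b) ∂μ := by
    have hm : AEMeasurable (fun x => ENNReal.ofReal (|f x| - a)) μ :=
      (hf.norm.sub_const a).ennreal_ofReal
    rw [← lintegral_add_left' hm]
    refine lintegral_mono fun x => ?_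
    refine (ENNReal.ofReal_le_ofReal ?_).trans ENNReal.ofReal_add_le
    have := abs_add_le (f x) (g x)
    linarith
  rw [ENNReal.ofReal_add ha hb, mul_add]
  calc _ ≤ _ := add_le_add le_rfl h3
    _ = _ := by ring

theorem rearr_const_mul_le (μ : Measure α) (f : α → ℝ) (c : ℝ) (s : ℝ) :
    rearr μ (fun x => c * f x) s ≤ ENNReal.ofReal |c| * rearr μ f s := by
  by_cases htop : rearr μ f s = ⊤
  · by_cases hc : c = 0
    · subst hc
      have : rearr μ (fun x => 0 * f x) s ≤ (0 : ℝ≥0) := by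
        rw [rearr_le_iff]; simp [distribFun]
      simpa using this
    · rw [htop, ENNReal.mul_top (by simpa using hc)]
      exact le_top
  · obtain ⟨r, hr⟩ : ∃ r : ℝ≥0, (r : ℝ≥0∞) = rearr μ f s :=
      ⟨_, ENNReal.coe_toNNReal htop⟩
    have h1 := (rearr_le_iff μ f s r).1 hr.ge
    have h2 : distribFun μ (fun x => c * f x) ((Real.nnabs c * r : ℝ≥0) : ℝ) ≤ ENNReal.ofReal s := by
      refine le_trans (measure_mono fun x hx => ?_) h1
      simp only [mem_ofPred_eq, NNReal.coe_mul, Real.coe_nnabs, abs_mul] at hx ⊢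
      exact lt_of_mul_lt_mul_left hx (abs_nonneg c)
    have h3 := (rearr_le_iff μ _ s _).2 h2
    rw [← hr, ← Real.coe_nnabs, ENNReal.ofReal_coe_nnreal, ← ENNReal.coe_mul]
    exact h3

theorem rearrInt_const_mul_le (μ : Measure α) (f : α → ℝ) (c : ℝ) (t : ℝ) :
    rearrInt μ (fun x => c * f x) t ≤ ENNReal.ofReal |c| * rearrInt μ f t := by
  unfold rearrInt
  rw [← lintegral_const_mul' _ _ ENNReal.ofReal_ne_top]
  exact lintegral_mono fun s => rearr_const_mul_le μ f c s

end Rearrangement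

/-- The half-open interval `[0, γ)`, for `0 ≤ γ ≤ ∞`. -/
def ico (γ : ℝ≥0∞) : Set ℝ := {t | 0 ≤ t ∧ ENNReal.ofReal t < γ}

/-- The open interval `(0, γ)`, for `0 ≤ γ ≤ ∞`. -/
def ioo (γ : ℝ≥0∞) : Set ℝ := {t | 0 < t ∧ ENNReal.ofReal t < γ}

/-- Lebesgue measure on `(0, γ)`. -/
noncomputable def leb (γ : ℝ≥0∞) : Measure ℝ := volume.restrict (ioo γ)

/-- `L_0(0, γ)`: real measurable functions on `(0, γ)` modulo equality almost everywhere. -/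
abbrev L0 (γ : ℝ≥0∞) : Type := ℝ →ₘ[leb γ] ℝ

instance (γ : ℝ≥0∞) : IsOrderedAddMonoid (L0 γ) where
  add_le_add_left f g h k := by
    rw [← AEEqFun.coeFn_le] at h ⊢
    filter_upwards [h, AEEqFun.coeFn_add f k, AEEqFun.coeFn_add g k] with x hx h1 h2
    rw [h1, h2]
    simpa using hx

/-- `sup_{0<t<γ} ψ(t)⁻¹ ∫_0^t f^*(s) ds`, as an element of `[0, ∞]`. -/
noncomputable def mnorm (γ : ℝ≥0∞) (ψ : ℝ → ℝ) (f : L0 γ) : ℝ≥0∞ :=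
  ⨆ t ∈ ioo γ, rearrInt (leb γ) f t / ENNReal.ofReal (ψ t)

section Gauge

variable {γ : ℝ≥0∞} {ψ : ℝ → ℝ}

theorem ae_abs_le_abs {f g : L0 γ} (h : |f| ≤ |g|) : ∀ᵐ x ∂leb γ, |f x| ≤ |g x| := by
  have h' := AEEqFun.coeFn_le.2 h
  filter_upwards [h', AEEqFun.coeFn_abs f, AEEqFun.coeFn_abs g] with x hx h1 h2
  rwa [h1, h2] at hx

theorem mnorm_mono {f g : L0 γ} (h : |f| ≤ |g|) : mnorm γ ψ f ≤ mnorm γ ψ g :=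
  iSup₂_mono fun t _ => ENNReal.div_le_div_right (rearrInt_mono (ae_abs_le_abs h) t) _

theorem mnorm_add_le (f g : L0 γ) : mnorm γ ψ (f + g) ≤ mnorm γ ψ f + mnorm γ ψ g := by
  refine iSup₂_le fun t ht => ?_
  have h1 : rearrInt (leb γ) (f + g : L0 γ) t ≤
      rearrInt (leb γ) f t + rearrInt (leb γ) g t := by
    refine le_trans (rearrInt_mono ?_ t)
      (rearrInt_add_le f.aemeasurable g.aemeasurable ht.1)
    filter_upwards [AEEqFun.coeFn_add f g] with x hx
    rw [hx]; simp
  refine (ENNReal.div_le_div_right h1 _).trans ?_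
  rw [ENNReal.add_div]
  exact add_le_add
    (le_iSup₂ (f := fun t (_ : t ∈ ioo γ) => rearrInt (leb γ) f t / ENNReal.ofReal (ψ t)) t ht)
    (le_iSup₂ (f := fun t (_ : t ∈ ioo γ) => rearrInt (leb γ) g t / ENNReal.ofReal (ψ t)) t ht)

theorem mnorm_smul_le (c : ℝ) (f : L0 γ) :
    mnorm γ ψ (c • f) ≤ ENNReal.ofReal |c| * mnorm γ ψ f := by
  refine iSup₂_le fun t ht => ?_
  have h1 : rearrInt (leb γ) (c • f : L0 γ) t ≤ ENNReal.ofReal |c| * rearrInt (leb γ) f t := by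
    refine le_trans (rearrInt_mono ?_ t) (rearrInt_const_mul_le _ _ _ _)
    filter_upwards [AEEqFun.coeFn_smul c f] with x hx
    rw [hx]; simp
  refine (ENNReal.div_le_div_right h1 _).trans ?_
  rw [mul_div_assoc]
  gcongr
  exact le_iSup₂ (f := fun t (_ : t ∈ ioo γ) =>
    rearrInt (leb γ) f t / ENNReal.ofReal (ψ t)) t ht

theorem mnorm_zero : mnorm γ ψ 0 = 0 := by
  simpa using mnorm_smul_le (ψ := ψ) 0 (0 : L0 γ)

theorem mnorm_neg (f : L0 γ) : mnorm γ ψ (-f) = mnorm γ ψ f :=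
  le_antisymm (mnorm_mono (abs_neg f).le) (mnorm_mono (abs_neg f).ge)

theorem eq_zero_of_mnorm (f : L0 γ) (h : mnorm γ ψ f = 0) : f = 0 := by
  have h1 : ∀ t ∈ ioo γ, distribFun (leb γ) f 0 ≤ ENNReal.ofReal t := by
    intro t ht
    have h2 : rearrInt (leb γ) f t / ENNReal.ofReal (ψ t) = 0 := by
      simp only [mnorm, ENNReal.iSup_eq_zero] at h
      exact h t ht
    rw [ENNReal.div_eq_zero_iff] at h2
    have h3 := h2.resolve_right ENNReal.ofReal_ne_top
    have h4 : ∫⁻ _ in Ioc 0 t, rearr (leb γ) f t ≤ rearrInt (leb γ) f t :=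
      setLIntegral_mono' measurableSet_Ioc fun s hs => rearr_antitone _ _ hs.2
    rw [h3, nonpos_iff_eq_zero] at h4
    have h5 : rearr (leb γ) f t = 0 := by
      have := ht.1
      simpa [not_le.2 this] using h4
    simpa using (rearr_le_iff (leb γ) f t 0).1 (by simp [h5])
  have h6 : distribFun (leb γ) f 0 = 0 := by
    by_cases hγ : γ = 0
    · have : ioo γ = ∅ := by ext; simp [ioo, hγ]
      simp [distribFun, leb, this]
    · rw [← nonpos_iff_eq_zero]
      refine le_of_forall_gt fun ε hε => ?_
      obtain ⟨q, hq0, hq⟩ := ENNReal.lt_iff_exists_nnreal_btwn.1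
        (lt_min hε (pos_iff_ne_zero.2 hγ))
      have hq' : (q : ℝ) ∈ ioo γ :=
        ⟨by exact_mod_cast hq0, by
          rw [ENNReal.ofReal_coe_nnreal]; exact hq.trans_le (min_le_right _ _)⟩
      refine (h1 q hq').trans_lt ?_
      rw [ENNReal.ofReal_coe_nnreal]; exact hq.trans_le (min_le_left _ _)
  apply AEEqFun.ext
  have h7 : ∀ᵐ x ∂leb γ, ¬ (0 < |f x|) := by
    rw [ae_iff]; simpa [distribFun] using h6
  filter_upwards [h7, AEEqFun.coeFn_zero (α := ℝ) (μ := leb γ) (β := ℝ)] with x hx h0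
  rw [h0]
  simpa using hx

end Gauge

/-- The Marcinkiewicz space `M_ψ(0, γ) = {f ∈ L_0(0, γ) : ‖f‖ < ∞}`. -/
def Marcinkiewicz (γ : ℝ≥0∞) (ψ : ℝ → ℝ) : Submodule ℝ (L0 γ) where
  carrier := {f | mnorm γ ψ f < ⊤}
  zero_mem' := by simp [mnorm_zero]
  add_mem' := fun hf hg => (mnorm_add_le _ _).trans_lt (ENNReal.add_lt_top.2 ⟨hf, hg⟩)
  smul_mem' := fun c _ hf =>
    (mnorm_smul_le c _).trans_lt (ENNReal.mul_lt_top ENNReal.ofReal_lt_top hf)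

section Space

variable {γ : ℝ≥0∞} {ψ : ℝ → ℝ}

theorem mem_of_abs_le {f g : L0 γ} (h : |f| ≤ |g|) (hg : g ∈ Marcinkiewicz γ ψ) :
    f ∈ Marcinkiewicz γ ψ :=
  (mnorm_mono h).trans_lt hg

theorem abs_mem {f : L0 γ} (hf : f ∈ Marcinkiewicz γ ψ) : |f| ∈ Marcinkiewicz γ ψ :=
  mem_of_abs_le (abs_abs f).le hf

theorem abs_le_abs_abs_add (f g : L0 γ) {h : L0 γ} (h1 : h ≤ |f| + |g|)
    (h2 : -h ≤ |f| + |g|) : |h| ≤ |(|f| + |g|)| :=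
  (abs_le'.2 ⟨h1, h2⟩).trans (le_abs_self _)

theorem sup_mem {f g : L0 γ} (hf : f ∈ Marcinkiewicz γ ψ) (hg : g ∈ Marcinkiewicz γ ψ) :
    f ⊔ g ∈ Marcinkiewicz γ ψ := by
  refine mem_of_abs_le (abs_le_abs_abs_add f g ?_ ?_) (add_mem (abs_mem hf) (abs_mem hg))
  · exact sup_le ((le_abs_self f).trans (le_add_of_nonneg_right (abs_nonneg g)))
      ((le_abs_self g).trans (le_add_of_nonneg_left (abs_nonneg f)))
  · exact (neg_le_neg le_sup_left).trans
      ((neg_le_abs f).trans (le_add_of_nonneg_right (abs_nonneg g)))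

theorem inf_mem {f g : L0 γ} (hf : f ∈ Marcinkiewicz γ ψ) (hg : g ∈ Marcinkiewicz γ ψ) :
    f ⊓ g ∈ Marcinkiewicz γ ψ := by
  have h := neg_mem (sup_mem (neg_mem hf) (neg_mem hg))
  rwa [neg_sup, neg_neg, neg_neg] at h

/-- `M_ψ(0, γ)` with the almost everywhere pointwise order is a vector lattice. -/
noncomputable instance : Lattice (Marcinkiewicz γ ψ) :=
  Subtype.lattice (fun _ _ hf hg => sup_mem hf hg) (fun _ _ hf hg => inf_mem hf hg)

/-- The Marcinkiewicz norm. -/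
noncomputable instance : NormedAddCommGroup (Marcinkiewicz γ ψ) :=
  AddGroupNorm.toNormedAddCommGroup
    { toFun := fun f => (mnorm γ ψ (f : L0 γ)).toReal
      map_zero' := by simp [mnorm_zero]
      add_le' := fun f g => by
        rw [← ENNReal.toReal_add f.2.ne g.2.ne]
        exact ENNReal.toReal_mono (ENNReal.add_ne_top.2 ⟨f.2.ne, g.2.ne⟩) (mnorm_add_le _ _)
      neg' := fun f => by simp [mnorm_neg]
      eq_zero_of_map_eq_zero' := fun f hf => by
        rw [ENNReal.toReal_eq_zero_iff] at hf
        exact Subtype.ext (eq_zero_of_mnorm _ (hf.resolve_right f.2.ne)) }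

theorem norm_def (f : Marcinkiewicz γ ψ) : ‖f‖ = (mnorm γ ψ (f : L0 γ)).toReal := rfl

noncomputable instance : NormedSpace ℝ (Marcinkiewicz γ ψ) where
  norm_smul_le c f := by
    rw [norm_def, norm_def, Real.norm_eq_abs, ← ENNReal.toReal_ofReal (abs_nonneg c),
      ← ENNReal.toReal_mul]
    exact ENNReal.toReal_mono (ENNReal.mul_ne_top ENNReal.ofReal_ne_top f.2.ne)
      (mnorm_smul_le _ _)

instance : IsOrderedAddMonoid (Marcinkiewicz γ ψ) where
  add_le_add_left _ _ h k := add_le_add_left (α := L0 γ) h k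

instance : HasSolidNorm (Marcinkiewicz γ ψ) where
  solid f g h := ENNReal.toReal_mono g.2.ne (mnorm_mono (show |(f : L0 γ)| ≤ |(g : L0 γ)| from h))

end Space

/-- The order of the dual of a normed lattice: `φ₁ ≤ φ₂` iff `φ₁ x ≤ φ₂ x` for all `x ≥ 0`. -/
@[reducible] def dualOrder (E : Type*) [NormedAddCommGroup E] [NormedSpace ℝ E] [Lattice E]
    [IsOrderedAddMonoid E] : PartialOrder (StrongDual ℝ E) where
  le φ₁ φ₂ := ∀ x : E, 0 ≤ x → φ₁ x ≤ φ₂ x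
  le_refl _ _ _ := le_rfl
  le_trans _ _ _ h₁ h₂ x hx := (h₁ x hx).trans (h₂ x hx)
  le_antisymm φ₁ φ₂ h₁ h₂ := by
    have h : ∀ x : E, 0 ≤ x → φ₁ x = φ₂ x := fun x hx => le_antisymm (h₁ x hx) (h₂ x hx)
    ext x
    rw [← posPart_sub_negPart x, map_sub, map_sub, h _ (posPart_nonneg x),
      h _ (negPart_nonneg x)]

noncomputable instance (γ : ℝ≥0∞) (ψ : ℝ → ℝ) : PartialOrder (StrongDual ℝ (Marcinkiewicz γ ψ)) :=
  dualOrder (Marcinkiewicz γ ψ)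

/-- The norm is order continuous: if a downward directed set `D`, viewed as a decreasing net,
has infimum `0`, then the net converges to `0` in norm. -/
def HasOrderContinuousNorm (F : Type*) [NormedAddCommGroup F] [PartialOrder F] : Prop :=
  ∀ D : Set F, D.Nonempty → DirectedOn (fun x y => y ≤ x) D → IsGLB D 0 →
    ∀ ε : ℝ, 0 < ε → ∃ x ∈ D, ∀ y ∈ D, y ≤ x → ‖y‖ < ε

/-- `γ = ∞`, `liminf_{t ↓ 0} ψ(2t)/ψ(t) > 1` and `liminf_{t → ∞} ψ(2t)/ψ(t) > 1`. -/
def ConditionA (γ : ℝ≥0∞) (ψ : ℝ → ℝ) : Prop :=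
  γ = ⊤ ∧
    (1 : EReal) < liminf (fun t : ℝ => ((ψ (2 * t) / ψ t : ℝ) : EReal)) (𝓝[>] 0) ∧
    (1 : EReal) < liminf (fun t : ℝ => ((ψ (2 * t) / ψ t : ℝ) : EReal)) atTop

/-- `γ < ∞` and `liminf_{t ↓ 0} ψ(2t)/ψ(t) > 1`. -/
def ConditionB (γ : ℝ≥0∞) (ψ : ℝ → ℝ) : Prop :=
  γ < ⊤ ∧
    (1 : EReal) < liminf (fun t : ℝ => ((ψ (2 * t) / ψ t : ℝ) : EReal)) (𝓝[>] 0)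

end Marc

/-!
The order continuity of a dual norm is a property of disjoint sequences. Suppose a decreasing net
of positive functionals with infimum `0`, hence pointwise null, stays large in norm. A gliding hump
picks functionals `φᵢ` of the net below a fixed `φ₀` and positive unit vectors `fᵢ` with `φᵢ(fᵢ)`
large and `φᵢ(fⱼ)` tiny for `j < i`. Replacing `fᵢ` by `(fᵢ - K ∑_{j<i} fⱼ - K⁻¹ ∑_{j>i} fⱼ)⁺`
makes the vectors disjoint at a small cost in `φᵢ(fᵢ)`, so `φ₀` is bounded below on arbitrarily many
disjoint unit vectors. This is impossible if averages of disjoint unit vectors can be made small.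

In `M_ψ` they can. If `h` is a sum of `n` disjoint elements of the unit ball, then
`h*(n u) ≤ ψ(u) / u`, and cutting `(0, t]` dyadically gives `∫₀ᵗ h* ≤ n ∑ₖ ψ(t / (n 2ᵏ⁺¹))`. The
conditions on `ψ(2t) / ψ(t)` make `ψ(t / 2ᵏ)` decay geometrically in `k`, uniformly in `t`, so for
`n = 2ᴺ` the right-hand side is at most `n ε ψ(t)` once `N` is large.
-/

namespace Marc

section LatticeOrderedModule

theorem abs_map_le_map_abs {F G H : Type*} [AddCommGroup G] [Lattice G]
    [AddCommGroup H] [Lattice H] [FunLike F G H] [AddMonoidHomClass F G H] {φ : F}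
    (hφ : Monotone φ) (x : G) : |φ x| ≤ φ |x| :=
  abs_le'.2 ⟨hφ (le_abs_self x), by rw [← map_neg]; exact hφ (neg_le_abs x)⟩

section PosSMulMono

variable {𝕜 E : Type*} [Field 𝕜] [LinearOrder 𝕜] [IsStrictOrderedRing 𝕜] [AddCommGroup E]
  [Lattice E] [IsOrderedAddMonoid E] [Module 𝕜 E] [PosSMulMono 𝕜 E]

theorem posPart_smul_le {c : 𝕜} (hc₀ : 0 ≤ c) (hc₁ : c ≤ 1) (x : E) : (c • x)⁺ ≤ x⁺ := by
  refine sup_le ?_ (posPart_nonneg x)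
  calc c • x ≤ c • x⁺ := smul_le_smul_of_nonneg_left (le_posPart x) hc₀
    _ ≤ x⁺ := smul_le_of_le_one_left (posPart_nonneg x) hc₁

theorem posPart_sub_inv_smul_inf_posPart_sub_smul {K : 𝕜} (hK : 1 ≤ K) (x y : E) :
    (x - K⁻¹ • y)⁺ ⊓ (y - K • x)⁺ = 0 := by
  have hK₀ : 0 < K := one_pos.trans_le hK
  have h_left : (x - K⁻¹ • y)⁺ ≤ (K • x - y)⁺ := by
    have h := posPart_smul_le (inv_nonneg.2 hK₀.le) (inv_le_one_of_one_le₀ hK) (K • x - y)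
    rwa [smul_sub, inv_smul_smul₀ hK₀.ne'] at h
  have h_right : (y - K • x)⁺ = (K • x - y)⁻ := by rw [← posPart_neg, neg_sub]
  refine le_antisymm ?_ (le_inf (posPart_nonneg _) (posPart_nonneg _))
  calc (x - K⁻¹ • y)⁺ ⊓ (y - K • x)⁺ ≤ (K • x - y)⁺ ⊓ (K • x - y)⁻ :=
        inf_le_inf h_left h_right.le
    _ = 0 := posPart_inf_negPart_eq_zero _

end PosSMulMono

section Disjointify

variable {𝕜 E ι : Type*} [Field 𝕜] [AddCommGroup E] [Lattice E] [Module 𝕜 E] [LinearOrder ι]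
  [LocallyFiniteOrderBot ι] [LocallyFiniteOrderTop ι]

/-- The disjointification of a family of positive elements of a vector lattice: subtracting a
large multiple of the earlier members and a small multiple of the later ones makes the positive
parts pairwise disjoint. -/
def disjointify (K : 𝕜) (f : ι → E) (i : ι) : E :=
  (f i - (K • ∑ j ∈ Finset.Iio i, f j + K⁻¹ • ∑ j ∈ Finset.Ioi i, f j))⁺

theorem disjointify_nonneg (K : 𝕜) (f : ι → E) (i : ι) : 0 ≤ disjointify K f i :=
  posPart_nonneg _

variable [LinearOrder 𝕜] [IsStrictOrderedRing 𝕜] {K : 𝕜} {f : ι → E} {i : ι}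

theorem map_sub_nsmul_le_map_disjointify [Fintype ι] {F : Type*} [FunLike F E 𝕜]
    [LinearMapClass F 𝕜 E 𝕜] {φ : F} (hφ : Monotone φ) {δ : 𝕜} (hδ : 0 ≤ δ)
    (h_before : ∀ j < i, K * φ (f j) ≤ δ) (h_after : ∀ j > i, K⁻¹ * φ (f j) ≤ δ) :
    φ (f i) - Fintype.card ι • δ ≤ φ (disjointify K f i) := by
  have h_cross : K * ∑ j ∈ Finset.Iio i, φ (f j) + K⁻¹ * ∑ j ∈ Finset.Ioi i, φ (f j) ≤
      Fintype.card ι • δ := by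
    have h_disj : Disjoint (Finset.Iio i) (Finset.Ioi i) := Finset.disjoint_left.2
      fun j hj hj' => (Finset.mem_Iio.1 hj).asymm (Finset.mem_Ioi.1 hj')
    rw [Finset.mul_sum, Finset.mul_sum]
    calc _ ≤ (Finset.Iio i).card • δ + (Finset.Ioi i).card • δ :=
          add_le_add
            (Finset.sum_le_card_nsmul _ _ _ fun j hj => h_before j (Finset.mem_Iio.1 hj))
            (Finset.sum_le_card_nsmul _ _ _ fun j hj => h_after j (Finset.mem_Ioi.1 hj))
      _ = (Finset.Iio i ∪ Finset.Ioi i).card • δ := by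
          rw [← add_nsmul, Finset.card_union_of_disjoint h_disj]
      _ ≤ Fintype.card ι • δ := nsmul_le_nsmul_left hδ (Finset.card_le_univ _)
  calc φ (f i) - Fintype.card ι • δ
      ≤ φ (f i) - (K * ∑ j ∈ Finset.Iio i, φ (f j) + K⁻¹ * ∑ j ∈ Finset.Ioi i, φ (f j)) :=
        sub_le_sub_left h_cross _
    _ = φ (f i - (K • ∑ j ∈ Finset.Iio i, f j + K⁻¹ • ∑ j ∈ Finset.Ioi i, f j)) := by
        simp only [map_sub, map_add, map_smul, map_sum, smul_eq_mul]
    _ ≤ φ (disjointify K f i) := hφ (le_posPart _)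

variable [IsOrderedAddMonoid E] [PosSMulMono 𝕜 E]

theorem disjointify_le (hK : 0 ≤ K) (hf : ∀ i, 0 ≤ f i) : disjointify K f i ≤ f i :=
  sup_le (sub_le_self _ (add_nonneg
    (smul_nonneg hK (Finset.sum_nonneg fun j _ => hf j))
    (smul_nonneg (inv_nonneg.2 hK) (Finset.sum_nonneg fun j _ => hf j)))) (hf i)

theorem disjointify_inf_eq_zero_of_lt (hK : 1 ≤ K) (hf : ∀ i, 0 ≤ f i) {j : ι} (hij : i < j) :
    disjointify K f i ⊓ disjointify K f j = 0 := by
  have hK₀ : 0 ≤ K := zero_le_one.trans hK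
  have h_sum (s : Finset ι) : 0 ≤ ∑ k ∈ s, f k := Finset.sum_nonneg fun k _ => hf k
  have h_single {s : Finset ι} {k : ι} (hk : k ∈ s) : f k ≤ ∑ l ∈ s, f l :=
    Finset.single_le_sum (fun l _ => hf l) hk
  have hi : disjointify K f i ≤ (f i - K⁻¹ • f j)⁺ :=
    posPart_mono (sub_le_sub_left (le_add_of_nonneg_of_le (smul_nonneg hK₀ (h_sum _))
      (smul_le_smul_of_nonneg_left (h_single (Finset.mem_Ioi.2 hij)) (inv_nonneg.2 hK₀))) _)
  have hj : disjointify K f j ≤ (f j - K • f i)⁺ :=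
    posPart_mono (sub_le_sub_left (le_add_of_le_of_nonneg
      (smul_le_smul_of_nonneg_left (h_single (Finset.mem_Iio.2 hij)) hK₀)
      (smul_nonneg (inv_nonneg.2 hK₀) (h_sum _))) _)
  refine le_antisymm ?_ (le_inf (disjointify_nonneg K f i) (disjointify_nonneg K f j))
  exact (inf_le_inf hi hj).trans_eq (posPart_sub_inv_smul_inf_posPart_sub_smul hK _ _)

theorem pairwise_disjointify_inf_eq_zero (hK : 1 ≤ K) (hf : ∀ i, 0 ≤ f i) :
    Pairwise fun i j => disjointify K f i ⊓ disjointify K f j = 0 := by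
  intro i j hij
  rcases hij.lt_or_gt with h | h
  · exact disjointify_inf_eq_zero_of_lt hK hf h
  · rw [inf_comm]
    exact disjointify_inf_eq_zero_of_lt hK hf h

end Disjointify

end LatticeOrderedModule

section DualOrder

variable {E ι : Type*} [NormedAddCommGroup E] [NormedSpace ℝ E] [Lattice E]
  [IsOrderedAddMonoid E]

attribute [local instance] dualOrder

theorem monotone_of_nonneg {φ : StrongDual ℝ E} (hφ : 0 ≤ φ) : Monotone φ :=
  (monotone_iff_map_nonneg φ).2 hφ

section SolidNorm

variable [HasSolidNorm E]

theorem norm_le_norm_of_nonneg_of_le {φ θ : StrongDual ℝ E} (hφ : 0 ≤ φ) (h : φ ≤ θ) :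
    ‖φ‖ ≤ ‖θ‖ := by
  refine φ.opNorm_le_bound (norm_nonneg _) fun x => ?_
  calc ‖φ x‖ ≤ φ |x| := abs_map_le_map_abs (monotone_of_nonneg hφ) x
    _ ≤ θ |x| := h _ (abs_nonneg x)
    _ ≤ ‖θ‖ * ‖|x|‖ := (le_abs_self _).trans (θ.le_opNorm _)
    _ = ‖θ‖ * ‖x‖ := by rw [norm_abs_eq_norm]

theorem exists_nonneg_lt_apply_of_lt_norm {φ : StrongDual ℝ E} (hφ : 0 ≤ φ) {c : ℝ}
    (hc : c < ‖φ‖) : ∃ x : E, 0 ≤ x ∧ ‖x‖ ≤ 1 ∧ c < φ x := by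
  obtain ⟨x, hx, hcx⟩ := φ.exists_lt_apply_of_lt_opNorm hc
  refine ⟨|x|, abs_nonneg x, (norm_abs_eq_norm x).trans_le hx.le, ?_⟩
  exact hcx.trans_le (abs_map_le_map_abs (monotone_of_nonneg hφ) x)

end SolidNorm

section Net

variable [Preorder ι] {φ : ι → StrongDual ℝ E}

theorem exists_tendsto_apply_atBot (hmono : Monotone φ) (hφ : ∀ i, 0 ≤ φ i) (x : E) :
    ∃ l : ℝ, Tendsto (fun i => φ i x) atBot (𝓝 l) := by
  have h_cone {y : E} (hy : 0 ≤ y) : Tendsto (fun i => φ i y) atBot (𝓝 (⨅ i, φ i y)) :=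
    tendsto_atBot_ciInf (fun i j hij => hmono hij y hy) ⟨0, by
      rintro _ ⟨i, rfl⟩
      exact hφ i y hy⟩
  refine ⟨_, ((h_cone (posPart_nonneg x)).sub (h_cone (negPart_nonneg x))).congr fun i => ?_⟩
  rw [← map_sub, posPart_sub_negPart]

variable [IsCodirectedOrder ι] [Nonempty ι] [HasSolidNorm E]

theorem exists_strongDual_tendsto_apply_atBot (hmono : Monotone φ) (hφ : ∀ i, 0 ≤ φ i) :
    ∃ θ : StrongDual ℝ E, ∀ x, Tendsto (fun i => φ i x) atBot (𝓝 (θ x)) := by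
  choose l hl using exists_tendsto_apply_atBot hmono hφ
  obtain ⟨i₀⟩ := ‹Nonempty ι›
  have h_bound (x : E) : ‖l x‖ ≤ ‖φ i₀‖ * ‖x‖ := by
    refine le_of_tendsto (hl x).norm ?_
    filter_upwards [eventually_le_atBot i₀] with i hi
    exact (φ i).le_of_opNorm_le (norm_le_norm_of_nonneg_of_le (hφ i) (hmono hi)) x
  exact ⟨(linearMapOfTendsto l (fun i => (φ i : E →ₗ[ℝ] ℝ)) (tendsto_pi_nhds.2 hl)).mkContinuous
    ‖φ i₀‖ h_bound, hl⟩

theorem tendsto_apply_atBot_of_isGLB (hmono : Monotone φ) (hglb : IsGLB (range φ) 0)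
    (x : E) : Tendsto (fun i => φ i x) atBot (𝓝 0) := by
  have hφ (i : ι) : 0 ≤ φ i := hglb.1 (mem_range_self i)
  obtain ⟨θ, hθ⟩ := exists_strongDual_tendsto_apply_atBot hmono hφ
  have hθ_nonneg : 0 ≤ θ := fun y hy => ge_of_tendsto' (hθ y) fun i => hφ i y hy
  have hθ_nonpos : θ ≤ 0 := hglb.2 <| by
    rintro _ ⟨i, rfl⟩ y hy
    refine le_of_tendsto (hθ y) ?_
    filter_upwards [eventually_le_atBot i] with j hj using hmono hj y hy
  simpa [le_antisymm hθ_nonpos hθ_nonneg] using hθ x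

end Net

variable [HasSolidNorm E] {D : Set (StrongDual ℝ E)} {φ₀ : StrongDual ℝ E} {c : ℝ}

theorem exists_le_apply_lt_of_isGLB (hdir : DirectedOn (· ≥ ·) D) (hglb : IsGLB D 0)
    (hφ₀ : φ₀ ∈ D) (x : E) {η : ℝ} (hη : 0 < η) :
    ∃ φ ∈ D, φ ≤ φ₀ ∧ φ x < η := by
  have : Nonempty D := ⟨⟨φ₀, hφ₀⟩⟩
  have : IsCodirectedOrder D := hdir.isCodirectedOrder
  have h_tendsto : Tendsto (fun φ : D => φ.1 x) atBot (𝓝 0) :=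
    tendsto_apply_atBot_of_isGLB (Subtype.mono_coe _) (by rwa [Subtype.range_coe]) x
  obtain ⟨φ, hφ, hle⟩ :=
    ((h_tendsto.eventually_lt_const hη).and (eventually_le_atBot ⟨φ₀, hφ₀⟩)).exists
  exact ⟨φ, φ.2, hle, hφ⟩

theorem exists_seq_lt_apply_self_and_apply_lt (hdir : DirectedOn (· ≥ ·) D) (hglb : IsGLB D 0)
    (hφ₀ : φ₀ ∈ D) (hc : ∀ φ ∈ D, c < ‖φ‖) {η : ℝ} (hη : 0 < η) :
    ∃ (φ : ℕ → StrongDual ℝ E) (f : ℕ → E), (∀ i, 0 ≤ φ i ∧ φ i ≤ φ₀) ∧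
      (∀ i, 0 ≤ f i ∧ ‖f i‖ ≤ 1) ∧ (∀ i, c < φ i (f i)) ∧ ∀ j i, j < i → φ i (f j) < η := by
  obtain ⟨p, hp, hlt⟩ := exists_seq_of_forall_finset_exists
    (fun p : StrongDual ℝ E × E =>
      (0 ≤ p.1 ∧ p.1 ≤ φ₀) ∧ (0 ≤ p.2 ∧ ‖p.2‖ ≤ 1) ∧ c < p.1 p.2)
    (fun p p' => p'.1 p.2 < η) fun s hs => by
      have h_nonneg : ∀ q ∈ s, 0 ≤ q.2 := fun q hq => (hs q hq).2.1.1
      obtain ⟨φ, hφ, hle, hφη⟩ :=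
        exists_le_apply_lt_of_isGLB hdir hglb hφ₀ (∑ q ∈ s, q.2) hη
      have hφ_nonneg : 0 ≤ φ := hglb.1 hφ
      obtain ⟨x, hx₀, hx₁, hx⟩ := exists_nonneg_lt_apply_of_lt_norm hφ_nonneg (hc φ hφ)
      exact ⟨(φ, x), ⟨⟨hφ_nonneg, hle⟩, ⟨hx₀, hx₁⟩, hx⟩, fun q hq =>
        (monotone_of_nonneg hφ_nonneg (Finset.single_le_sum h_nonneg hq)).trans_lt hφη⟩
  exact ⟨fun i => (p i).1, fun i => (p i).2, fun i => (hp i).1, fun i => (hp i).2.1,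
    fun i => (hp i).2.2, hlt⟩

variable [PosSMulMono ℝ E]

theorem exists_disjoint_le_apply (hdir : DirectedOn (· ≥ ·) D) (hglb : IsGLB D 0)
    (hφ₀ : φ₀ ∈ D) (hc₀ : 0 < c) (hc : ∀ φ ∈ D, c < ‖φ‖) (n : ℕ) :
    ∃ g : Fin n → E, (∀ i, 0 ≤ g i) ∧ (∀ i, ‖g i‖ ≤ 1) ∧ (Pairwise fun i j => g i ⊓ g j = 0) ∧
      ∀ i, c / 2 ≤ φ₀ (g i) := by
  set δ : ℝ := c / (2 * (n + 1)) with hδ_def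
  have hδ : 0 < δ := by positivity
  set K : ℝ := 1 + ‖φ₀‖ / δ with hK_def
  have hK₁ : 1 ≤ K := le_add_of_nonneg_right (by positivity)
  have hK₀ : 0 < K := one_pos.trans_le hK₁
  have hφ₀_le : ‖φ₀‖ ≤ K * δ := by
    rw [hK_def, add_mul, div_mul_cancel₀ _ hδ.ne', one_mul]
    exact le_add_of_nonneg_left hδ.le
  obtain ⟨φ, f, hφ, hf, hcf, h_hump⟩ :=
    exists_seq_lt_apply_self_and_apply_lt hdir hglb hφ₀ hc (div_pos hδ hK₀)
  let f' : Fin n → E := fun i => f i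
  have hf' (i : Fin n) : 0 ≤ f' i := (hf i).1
  have hg (i : Fin n) : 0 ≤ disjointify K f' i := disjointify_nonneg K f' i
  refine ⟨disjointify K f', hg, fun i => ?_, pairwise_disjointify_inf_eq_zero hK₁ hf', fun i => ?_⟩
  · refine (norm_le_norm_of_abs_le_abs ?_).trans (hf i).2
    exact abs_le_abs_of_nonneg (hg i) (disjointify_le hK₀.le hf')
  have h_before (j : Fin n) (hj : j < i) : K * φ i (f' j) ≤ δ := by
    rw [← le_div_iff₀' hK₀]
    exact (h_hump j i hj).le
  have h_after (j : Fin n) (_ : j > i) : K⁻¹ * φ i (f' j) ≤ δ := by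
    rw [inv_mul_le_iff₀ hK₀]
    calc φ i (f' j) ≤ φ₀ (f' j) := (hφ i).2 _ (hf' j)
      _ ≤ ‖φ₀‖ * ‖f' j‖ := (le_abs_self _).trans (φ₀.le_opNorm _)
      _ ≤ K * δ := (mul_le_of_le_one_right (norm_nonneg _) (hf j).2).trans hφ₀_le
  have h_loss : Fintype.card (Fin n) • δ ≤ c / 2 := by
    rw [Fintype.card_fin, nsmul_eq_mul, hδ_def, mul_div_assoc', div_le_div_iff₀ (by positivity)
      two_pos]
    nlinarith
  calc c / 2 ≤ φ i (f' i) - Fintype.card (Fin n) • δ := by linarith [hcf i]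
    _ ≤ φ i (disjointify K f' i) :=
        map_sub_nsmul_le_map_disjointify (monotone_of_nonneg (hφ i).1) hδ.le h_before h_after
    _ ≤ φ₀ (disjointify K f' i) := (hφ i).2 _ (hg i)

end DualOrder

/-- Averages of pairwise disjoint positive elements of the unit ball can be made uniformly small
in norm by a suitable choice of their number. -/
def HasSmallDisjointAverages (E : Type*) [NormedAddCommGroup E] [Lattice E] : Prop :=
  ∀ ε : ℝ, 0 < ε → ∃ n : ℕ, 0 < n ∧ ∀ g : Fin n → E, (∀ i, 0 ≤ g i) → (∀ i, ‖g i‖ ≤ 1) →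
    (Pairwise fun i j => g i ⊓ g j = 0) → ‖∑ i, g i‖ ≤ ε * n

theorem HasSmallDisjointAverages.hasOrderContinuousNorm_dual {E : Type*} [NormedAddCommGroup E]
    [NormedSpace ℝ E] [Lattice E] [IsOrderedAddMonoid E] [HasSolidNorm E] [PosSMulMono ℝ E]
    (hE : HasSmallDisjointAverages E) :
    @HasOrderContinuousNorm (StrongDual ℝ E) _ (dualOrder E) := by
  intro D hD hdir hglb ε hε
  suffices h : ∃ φ ∈ D, ‖φ‖ < ε by
    obtain ⟨φ, hφ, hφε⟩ := h
    exact ⟨φ, hφ, fun θ hθ hle => (norm_le_norm_of_nonneg_of_le (hglb.1 hθ) hle).trans_lt hφε⟩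
  by_contra! h_large
  obtain ⟨φ₀, hφ₀⟩ := hD
  set δ : ℝ := ε / (4 * (‖φ₀‖ + 1)) with hδ_def
  have hδ : 0 < δ := by positivity
  have hφ₀δ : ‖φ₀‖ * δ < ε / 4 := by
    calc ‖φ₀‖ * δ < (‖φ₀‖ + 1) * δ := by gcongr; exact lt_add_one _
      _ = ε / 4 := by rw [hδ_def]; field_simp
  obtain ⟨n, hn, h_avg⟩ := hE δ hδ
  obtain ⟨g, hg₀, hg₁, hg_disj, hg⟩ := exists_disjoint_le_apply hdir hglb hφ₀ (half_pos hε)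
    (fun φ hφ => (half_lt_self hε).trans_le (h_large φ hφ)) n
  have h_lt : n * (ε / 4) < n * (ε / 4) :=
    calc n * (ε / 4) = ∑ _i : Fin n, ε / 2 / 2 := by
          rw [Finset.sum_const, Finset.card_univ, Fintype.card_fin, nsmul_eq_mul]; ring
      _ ≤ ∑ i, φ₀ (g i) := Finset.sum_le_sum fun i _ => hg i
      _ = φ₀ (∑ i, g i) := (map_sum φ₀ g _).symm
      _ ≤ ‖φ₀‖ * ‖∑ i, g i‖ := (le_abs_self _).trans (φ₀.le_opNorm _)
      _ ≤ ‖φ₀‖ * (δ * n) := by gcongr; exact h_avg g hg₀ hg₁ hg_disj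
      _ = n * (‖φ₀‖ * δ) := by ring
      _ < n * (ε / 4) := by gcongr
  exact h_lt.false

section DisjointSum

variable {α ι : Type*} [MeasurableSpace α] {μ : Measure α} {s : Finset ι} {f : ι → α → ℝ}

theorem distribFun_sum_le_of_disjoint
    (hf : ∀ᵐ x ∂μ, (s : Set ι).Pairwise fun i j => f i x = 0 ∨ f j x = 0) {r : ℝ} (hr : 0 ≤ r) :
    distribFun μ (fun x => ∑ i ∈ s, f i x) r ≤ ∑ i ∈ s, distribFun μ (f i) r := by
  refine (measure_mono_ae ?_).trans (measure_biUnion_finset_le s fun i => {x | r < |f i x|})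
  filter_upwards [hf] with x hx (hrx : r < |∑ i ∈ s, f i x|)
  obtain ⟨i, hi, hfi⟩ : ∃ i ∈ s, f i x ≠ 0 :=
    Finset.exists_ne_zero_of_sum_ne_zero (abs_pos.1 (hr.trans_lt hrx))
  have h_sum : ∑ j ∈ s, f j x = f i x :=
    Finset.sum_eq_single_of_mem i hi fun j hj hji => (hx hj hi hji).resolve_right hfi
  rw [h_sum] at hrx
  exact mem_iUnion₂.2 ⟨i, hi, hrx⟩

theorem rearr_sum_le_of_disjoint
    (hf : ∀ᵐ x ∂μ, (s : Set ι).Pairwise fun i j => f i x = 0 ∨ f j x = 0) {u : ℝ} {r : ℝ≥0∞}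
    (hr : ∀ i ∈ s, rearr μ (f i) u ≤ r) :
    rearr μ (fun x => ∑ i ∈ s, f i x) (s.card * u) ≤ r := by
  induction r with
  | top => exact le_top
  | coe r =>
    simp only [rearr_le_iff] at hr ⊢
    calc distribFun μ (fun x => ∑ i ∈ s, f i x) r
        ≤ ∑ i ∈ s, distribFun μ (f i) r := distribFun_sum_le_of_disjoint hf r.2
      _ ≤ s.card • ENNReal.ofReal u := Finset.sum_le_card_nsmul _ _ _ hr
      _ = ENNReal.ofReal (s.card * u) := by
          rw [ENNReal.ofReal_mul s.card.cast_nonneg, ENNReal.ofReal_natCast, nsmul_eq_mul]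

theorem ofReal_mul_rearr_le_rearrInt (μ : Measure α) (f : α → ℝ) (t : ℝ) :
    ENNReal.ofReal t * rearr μ f t ≤ rearrInt μ f t :=
  calc ENNReal.ofReal t * rearr μ f t = ∫⁻ _ in Ioc 0 t, rearr μ f t := by
        rw [setLIntegral_const, Real.volume_Ioc, sub_zero, mul_comm]
    _ ≤ rearrInt μ f t :=
        setLIntegral_mono' measurableSet_Ioc fun _ hs => rearr_antitone μ f hs.2

theorem ofReal_mul_rearr_sum_le_of_disjoint
    (hf : ∀ᵐ x ∂μ, (s : Set ι).Pairwise fun i j => f i x = 0 ∨ f j x = 0) {u : ℝ} (hu : 0 < u)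
    {a : ℝ≥0∞} (ha : ∀ i ∈ s, rearrInt μ (f i) u ≤ a) :
    ENNReal.ofReal (s.card * u) * rearr μ (fun x => ∑ i ∈ s, f i x) (s.card * u) ≤
      s.card * a := by
  have hu₀ : ENNReal.ofReal u ≠ 0 := (ENNReal.ofReal_pos.2 hu).ne'
  have h_rearr (i : ι) (hi : i ∈ s) : rearr μ (f i) u ≤ a / ENNReal.ofReal u := by
    rw [ENNReal.le_div_iff_mul_le (.inl hu₀) (.inl ENNReal.ofReal_ne_top), mul_comm]
    exact (ofReal_mul_rearr_le_rearrInt μ (f i) u).trans (ha i hi)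
  calc ENNReal.ofReal (s.card * u) * rearr μ (fun x => ∑ i ∈ s, f i x) (s.card * u)
      ≤ ENNReal.ofReal (s.card * u) * (a / ENNReal.ofReal u) := by
        gcongr; exact rearr_sum_le_of_disjoint hf h_rearr
    _ = s.card * a := by
        rw [ENNReal.ofReal_mul s.card.cast_nonneg, ENNReal.ofReal_natCast, mul_assoc,
          ENNReal.mul_div_cancel hu₀ ENNReal.ofReal_ne_top]

theorem Ioc_zero_subset_iUnion_dyadic (t : ℝ) :
    Ioc 0 t ⊆ ⋃ k : ℕ, Ioc (t / 2 ^ (k + 1)) (t / 2 ^ k) := by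
  rintro s ⟨hs, hst⟩
  obtain ⟨k, hk, hk'⟩ := exists_nat_pow_near ((one_le_div hs).2 hst) one_lt_two
  refine mem_iUnion.2 ⟨k, ?_, ?_⟩
  · rwa [div_lt_comm₀ (by positivity) hs]
  · rwa [le_div_comm₀ hs (by positivity)]

theorem rearrInt_le_tsum_dyadic (μ : Measure α) (f : α → ℝ) (t : ℝ) :
    rearrInt μ f t ≤
      ∑' k : ℕ, ENNReal.ofReal (t / 2 ^ (k + 1)) * rearr μ f (t / 2 ^ (k + 1)) := by
  have h_block (k : ℕ) : ∫⁻ s in Ioc (t / 2 ^ (k + 1)) (t / 2 ^ k), rearr μ f s ≤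
      ENNReal.ofReal (t / 2 ^ (k + 1)) * rearr μ f (t / 2 ^ (k + 1)) :=
    calc ∫⁻ s in Ioc (t / 2 ^ (k + 1)) (t / 2 ^ k), rearr μ f s
        ≤ ∫⁻ _ in Ioc (t / 2 ^ (k + 1)) (t / 2 ^ k), rearr μ f (t / 2 ^ (k + 1)) :=
          setLIntegral_mono' measurableSet_Ioc fun _ hs => rearr_antitone μ f hs.1.le
      _ = ENNReal.ofReal (t / 2 ^ (k + 1)) * rearr μ f (t / 2 ^ (k + 1)) := by
          rw [setLIntegral_const, Real.volume_Ioc, mul_comm]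
          congr 2
          field_simp
          ring
  calc rearrInt μ f t ≤ ∫⁻ s in ⋃ k : ℕ, Ioc (t / 2 ^ (k + 1)) (t / 2 ^ k), rearr μ f s :=
        lintegral_mono_set (Ioc_zero_subset_iUnion_dyadic t)
    _ ≤ ∑' k : ℕ, ∫⁻ s in Ioc (t / 2 ^ (k + 1)) (t / 2 ^ k), rearr μ f s := lintegral_iUnion_le _ _
    _ ≤ _ := ENNReal.tsum_le_tsum h_block

theorem rearrInt_sum_le_of_disjoint (hs : s.Nonempty)
    (hf : ∀ᵐ x ∂μ, (s : Set ι).Pairwise fun i j => f i x = 0 ∨ f j x = 0) {t : ℝ} (ht : 0 < t)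
    {a : ℕ → ℝ≥0∞} (ha : ∀ k, ∀ i ∈ s, rearrInt μ (f i) (t / (s.card * 2 ^ (k + 1))) ≤ a k) :
    rearrInt μ (fun x => ∑ i ∈ s, f i x) t ≤ s.card * ∑' k, a k := by
  have h_card : (0 : ℝ) < s.card := Nat.cast_pos.2 hs.card_pos
  have h_split (k : ℕ) : t / 2 ^ (k + 1) = s.card * (t / (s.card * 2 ^ (k + 1))) := by
    field_simp
  rw [← ENNReal.tsum_mul_left]
  refine (rearrInt_le_tsum_dyadic μ _ t).trans (ENNReal.tsum_le_tsum fun k => ?_)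
  rw [h_split k]
  exact ofReal_mul_rearr_sum_le_of_disjoint hf (by positivity) (ha k)

end DisjointSum

section GeometricDecay

variable {γ : ℝ≥0∞} {ψ : ℝ → ℝ}

theorem ioo_subset_ico : ioo γ ⊆ ico γ := fun _ ht => ⟨ht.1.le, ht.2⟩

theorem mem_ioo_of_le {s t : ℝ} (ht : t ∈ ioo γ) (hs : 0 < s) (hst : s ≤ t) : s ∈ ioo γ :=
  ⟨hs, (ENNReal.ofReal_le_ofReal hst).trans_lt ht.2⟩

theorem div_mem_ioo {t c : ℝ} (ht : t ∈ ioo γ) (hc : 1 ≤ c) : t / c ∈ ioo γ :=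
  mem_ioo_of_le ht (div_pos ht.1 (one_pos.trans_le hc)) (div_le_self ht.1.le hc)

theorem pos_of_one_lt_liminf (hψ : MonotoneOn ψ (ioo γ))
    (h : (1 : EReal) < liminf (fun t : ℝ => ((ψ (2 * t) / ψ t : ℝ) : EReal)) (𝓝[>] 0))
    {t : ℝ} (ht : t ∈ ioo γ) : 0 < ψ t := by
  have h_small : ∀ᶠ s in 𝓝[>] (0 : ℝ), s ∈ Ioo 0 (t / 2) := Ioo_mem_nhdsGT (half_pos ht.1)
  obtain ⟨s, h_ratio, hs₀, hst⟩ := ((eventually_lt_of_lt_liminf h).and h_small).exists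
  have h2s : 2 * s ∈ ioo γ := mem_ioo_of_le ht (by positivity) (by linarith)
  have h_double : ψ s ≤ ψ (2 * s) := hψ (mem_ioo_of_le h2s hs₀ (by linarith)) h2s (by linarith)
  -- The quotient is `0` where `ψ` vanishes, so its exceeding `1` also rules out `ψ s = 0`.
  rcases one_lt_div_iff.1 (EReal.coe_lt_coe_iff.1 h_ratio) with ⟨hpos, -⟩ | ⟨-, hlt⟩
  · exact hpos.trans_le (h_double.trans (hψ h2s ht (by linarith)))
  · exact absurd h_double hlt.not_ge

theorem exists_eventually_le_mul_of_one_lt_liminf {l : Filter ℝ}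
    (h : (1 : EReal) < liminf (fun t : ℝ => ((ψ (2 * t) / ψ t : ℝ) : EReal)) l) :
    ∃ q ∈ Ioo (0 : ℝ) 1, ∀ᶠ t in l, 0 < ψ t → ψ t ≤ q * ψ (2 * t) := by
  obtain ⟨c, hc, h⟩ := EReal.lt_iff_exists_real_btwn.1 h
  have hc₁ : 1 < c := EReal.coe_lt_coe_iff.1 hc
  have hc₀ : 0 < c := one_pos.trans hc₁
  refine ⟨c⁻¹, ⟨inv_pos.2 hc₀, inv_lt_one_of_one_lt₀ hc₁⟩, ?_⟩
  filter_upwards [eventually_lt_of_lt_liminf h] with t ht hψt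
  rw [le_inv_mul_iff₀ hc₀, ← le_div_iff₀ hψt]
  exact (EReal.coe_lt_coe_iff.1 ht).le

theorem exists_eventually_le_mul (hψ : ∀ t ∈ ioo γ, 0 < ψ t)
    (hAB : ConditionA γ ψ ∨ ConditionB γ ψ) :
    ∃ q ∈ Ioo (0 : ℝ) 1, ∀ᶠ t in 𝓝[>] 0 ⊔ atTop, 2 * t ∈ ioo γ → ψ t ≤ q * ψ (2 * t) := by
  have h_pos {t : ℝ} (ht : 2 * t ∈ ioo γ) : 0 < ψ t :=
    hψ t (by simpa using div_mem_ioo ht one_le_two)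
  rcases hAB with ⟨-, h_zero, h_top⟩ | ⟨hγ, h_zero⟩
  · obtain ⟨q, hq, h⟩ := exists_eventually_le_mul_of_one_lt_liminf
      (show (1 : EReal) < liminf _ (𝓝[>] 0 ⊔ atTop) by
        rw [liminf_sup_filter]; exact lt_min h_zero h_top)
    exact ⟨q, hq, h.mono fun t ht h2t => ht (h_pos h2t)⟩
  · obtain ⟨q, hq, h⟩ := exists_eventually_le_mul_of_one_lt_liminf h_zero
    refine ⟨q, hq, eventually_sup.2 ⟨h.mono fun t ht h2t => ht (h_pos h2t), ?_⟩⟩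
    filter_upwards [eventually_ge_atTop γ.toReal, eventually_ge_atTop 0] with t ht ht₀ h2t
    have h2t' : 2 * t < γ.toReal := (ENNReal.ofReal_lt_iff_lt_toReal h2t.1.le hγ.ne).1 h2t.2
    linarith

theorem exists_monotone_le_mul_two_mul {q a b : ℝ} (hq : q ∈ Ioo (0 : ℝ) 1) (ha : 0 < a)
    (hab : a ≤ b) :
    ∃ (w : ℝ → ℝ) (m M : ℝ), Monotone w ∧ 0 < m ∧ (∀ t, w t ∈ Icc m M) ∧
      ∀ t, a ≤ t → 2 * t ≤ b → w t ≤ q * w (2 * t) := by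
  -- `t ^ α` satisfies `t ^ α = q * (2 * t) ^ α`; clamping `t` to `[a, b]` makes it bounded.
  set α : ℝ := Real.logb 2 q⁻¹
  have hα : 0 < α := Real.logb_pos one_lt_two ((one_lt_inv₀ hq.1).2 hq.2)
  have h_two : (2 : ℝ) ^ α = q⁻¹ := Real.rpow_logb two_pos (by norm_num) (inv_pos.2 hq.1)
  have h_clamp (t : ℝ) : max a (min t b) ∈ Icc a b :=
    ⟨le_max_left _ _, max_le hab (min_le_right _ _)⟩
  refine ⟨fun t => max a (min t b) ^ α, a ^ α, b ^ α, fun s t hst => ?_, by positivity,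
    fun t => ⟨?_, ?_⟩, fun t hat htb => ?_⟩
  · have h_nonneg := ha.le.trans (h_clamp s).1
    dsimp only
    gcongr
  · exact Real.rpow_le_rpow ha.le (h_clamp t).1 hα.le
  · exact Real.rpow_le_rpow (ha.le.trans (h_clamp t).1) (h_clamp t).2 hα.le
  · have ht : 0 < t := ha.trans_le hat
    dsimp only
    rw [min_eq_left htb, min_eq_left (by linarith), max_eq_right hat, max_eq_right (by linarith),
      Real.mul_rpow two_pos.le ht.le, h_two, mul_inv_cancel_left₀ hq.1.ne']

/-- Geometric decay of a function on `(0, γ)` along dyadic fractions `t / 2 ^ k`, uniform in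
`t`. -/
def HasGeometricDecay (γ : ℝ≥0∞) (ψ : ℝ → ℝ) : Prop :=
  ∃ A > 0, ∃ q ∈ Ioo (0 : ℝ) 1, ∀ k : ℕ, ∀ t ∈ ioo γ, ψ (t / 2 ^ k) ≤ A * q ^ k * ψ t

theorem hasGeometricDecay_of_mul_half_le (hψ : ∀ t ∈ ioo γ, 0 ≤ ψ t) {q m M : ℝ}
    (hq : q ∈ Ioo (0 : ℝ) 1) (hm : 0 < m) {w : ℝ → ℝ} (hw : ∀ t, w t ∈ Icc m M)
    (h_half : ∀ t ∈ ioo γ, w (t / 2) * ψ (t / 2) ≤ q * (w t * ψ t)) : HasGeometricDecay γ ψ := by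
  have h_iter (k : ℕ) {t : ℝ} (ht : t ∈ ioo γ) :
      w (t / 2 ^ k) * ψ (t / 2 ^ k) ≤ q ^ k * (w t * ψ t) := by
    induction k with
    | zero => simp
    | succ k ih =>
      have h_step := h_half _ (div_mem_ioo ht (one_le_pow₀ one_le_two (n := k)))
      rw [div_div, ← pow_succ] at h_step
      calc _ ≤ q * (w (t / 2 ^ k) * ψ (t / 2 ^ k)) := h_step
        _ ≤ q * (q ^ k * (w t * ψ t)) := mul_le_mul_of_nonneg_left ih hq.1.le
        _ = q ^ (k + 1) * (w t * ψ t) := by ring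
  have hM : 0 < M := hm.trans_le ((hw 0).1.trans (hw 0).2)
  refine ⟨M / m, div_pos hM hm, q, hq, fun k t ht => ?_⟩
  have ht' : 0 ≤ ψ (t / 2 ^ k) := hψ _ (div_mem_ioo ht (one_le_pow₀ one_le_two))
  have hqk : 0 ≤ q ^ k := pow_nonneg hq.1.le k
  rw [div_mul_eq_mul_div, div_mul_eq_mul_div, le_div_iff₀' hm]
  calc m * ψ (t / 2 ^ k) ≤ w (t / 2 ^ k) * ψ (t / 2 ^ k) := by gcongr; exact (hw _).1
    _ ≤ q ^ k * (w t * ψ t) := h_iter k ht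
    _ ≤ q ^ k * (M * ψ t) := by gcongr; exacts [hψ t ht, (hw t).2]
    _ = M * q ^ k * ψ t := by ring

theorem hasGeometricDecay_of_eventually_le_mul (hψ_mono : MonotoneOn ψ (ioo γ))
    (hψ_nonneg : ∀ t ∈ ioo γ, 0 ≤ ψ t) {q : ℝ} (hq : q ∈ Ioo (0 : ℝ) 1)
    (h : ∀ᶠ t in 𝓝[>] 0 ⊔ atTop, 2 * t ∈ ioo γ → ψ t ≤ q * ψ (2 * t)) :
    HasGeometricDecay γ ψ := by
  obtain ⟨h_zero, h_top⟩ := eventually_sup.1 h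
  obtain ⟨a, ha, h_zero⟩ := mem_nhdsGT_iff_exists_Ioo_subset.1 h_zero
  obtain ⟨b, hb⟩ := eventually_atTop.1 h_top
  -- Where the hypothesis says nothing about `ψ`, the bounded weight `w` gains the factor `q`.
  obtain ⟨w, m, M, hw_mono, hm, hw, hw_mul⟩ :=
    exists_monotone_le_mul_two_mul hq ha (le_max_left a (2 * b))
  have hw_pos (t : ℝ) : 0 < w t := hm.trans_le (hw t).1
  refine hasGeometricDecay_of_mul_half_le hψ_nonneg hq hm hw fun t ht => ?_
  obtain ⟨u, rfl⟩ : ∃ u, t = 2 * u := ⟨t / 2, (mul_div_cancel₀ t two_ne_zero).symm⟩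
  rw [mul_div_cancel_left₀ u two_ne_zero]
  have hu₀ : 0 < u := pos_of_mul_pos_right ht.1 two_pos.le
  have hu_le : u ≤ 2 * u := by linarith
  have hu : u ∈ ioo γ := mem_ioo_of_le ht hu₀ hu_le
  have h_gain : w u ≤ q * w (2 * u) ∨ ψ u ≤ q * ψ (2 * u) := by
    rcases lt_or_ge u a with h_near | h_far
    · exact .inr (h_zero ⟨hu₀, h_near⟩ ht)
    rcases le_or_gt b u with h_large | h_mid
    · exact .inr (hb u h_large ht)
    · exact .inl (hw_mul u h_far (le_max_of_le_right (by linarith)))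
  rcases h_gain with hwu | hψu
  · calc w u * ψ u ≤ q * w (2 * u) * ψ (2 * u) :=
          mul_le_mul hwu (hψ_mono hu ht hu_le) (hψ_nonneg u hu) (mul_pos hq.1 (hw_pos _)).le
      _ = q * (w (2 * u) * ψ (2 * u)) := mul_assoc _ _ _
  · calc w u * ψ u ≤ w (2 * u) * (q * ψ (2 * u)) :=
          mul_le_mul (hw_mono hu_le) hψu (hψ_nonneg u hu) (hw_pos _).le
      _ = q * (w (2 * u) * ψ (2 * u)) := mul_left_comm _ _ _

theorem tsum_ofReal_le_of_forall_le_mul_pow {x : ℕ → ℝ} {C q : ℝ} (hC : 0 ≤ C)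
    (hq : q ∈ Ioo (0 : ℝ) 1) (hx : ∀ k, x k ≤ C * q ^ k) :
    ∑' k, ENNReal.ofReal (x k) ≤ ENNReal.ofReal (C / (1 - q)) :=
  calc ∑' k, ENNReal.ofReal (x k) ≤ ∑' k, ENNReal.ofReal (C * q ^ k) :=
        ENNReal.tsum_le_tsum fun k => ENNReal.ofReal_le_ofReal (hx k)
    _ = ENNReal.ofReal (∑' k, C * q ^ k) :=
        (ENNReal.ofReal_tsum_of_nonneg (fun k => mul_nonneg hC (pow_nonneg hq.1.le k))
          ((summable_geometric_of_lt_one hq.1.le hq.2).mul_left C)).symm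
    _ = ENNReal.ofReal (C / (1 - q)) := by
        rw [tsum_mul_left, tsum_geometric_of_lt_one hq.1.le hq.2, div_eq_mul_inv]

theorem HasGeometricDecay.exists_tsum_ofReal_le (h : HasGeometricDecay γ ψ)
    (hψ : ∀ t ∈ ioo γ, 0 ≤ ψ t) {ε : ℝ} (hε : 0 < ε) :
    ∃ N : ℕ, ∀ t ∈ ioo γ,
      ∑' k : ℕ, ENNReal.ofReal (ψ (t / (2 ^ N * 2 ^ (k + 1)))) ≤ ENNReal.ofReal (ε * ψ t) := by
  obtain ⟨A, hA, q, hq, h_decay⟩ := h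
  have hq' : 0 < 1 - q := sub_pos.2 hq.2
  obtain ⟨N, hN⟩ := exists_pow_lt_of_lt_one (show 0 < ε * (1 - q) / A by positivity) hq.2
  have h_small : A * q ^ (N + 1) / (1 - q) ≤ ε := by
    rw [div_le_iff₀ hq', ← le_div_iff₀' hA]
    exact (pow_le_pow_of_le_one hq.1.le hq.2.le N.le_succ).trans hN.le
  have hAq : 0 ≤ A * q ^ (N + 1) := mul_nonneg hA.le (pow_nonneg hq.1.le _)
  refine ⟨N, fun t ht => ?_⟩
  have h_term (k : ℕ) : ψ (t / (2 ^ N * 2 ^ (k + 1))) ≤ A * q ^ (N + 1) * ψ t * q ^ k := by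
    rw [← pow_add]
    exact (h_decay _ t ht).trans_eq (by ring)
  refine (tsum_ofReal_le_of_forall_le_mul_pow (mul_nonneg hAq (hψ t ht)) hq h_term).trans
    (ENNReal.ofReal_le_ofReal ?_)
  rw [mul_div_right_comm]
  exact mul_le_mul_of_nonneg_right h_small (hψ t ht)

end GeometricDecay

section Space

variable {γ : ℝ≥0∞} {ψ : ℝ → ℝ}

instance : PosSMulMono ℝ (Marcinkiewicz γ ψ) where
  smul_le_smul_of_nonneg_left c hc f g hfg := by
    have h : (f : L0 γ) ≤ g := hfg
    change (c • f : L0 γ) ≤ (c • g : L0 γ)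
    rw [← AEEqFun.coeFn_le] at h ⊢
    filter_upwards [h, AEEqFun.coeFn_smul c (f : L0 γ), AEEqFun.coeFn_smul c (g : L0 γ)]
      with x hx hf hg
    rw [hf, hg]
    exact mul_le_mul_of_nonneg_left hx hc

theorem rearrInt_le_norm_mul {f : Marcinkiewicz γ ψ} {t : ℝ} (ht : t ∈ ioo γ) (hψ : 0 < ψ t) :
    rearrInt (leb γ) (f : L0 γ) t ≤ ENNReal.ofReal (‖f‖ * ψ t) := by
  have h_le : rearrInt (leb γ) (f : L0 γ) t / ENNReal.ofReal (ψ t) ≤ mnorm γ ψ f :=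
    le_iSup₂ (f := fun t (_ : t ∈ ioo γ) =>
      rearrInt (leb γ) (f : L0 γ) t / ENNReal.ofReal (ψ t)) t ht
  rwa [ENNReal.div_le_iff (ENNReal.ofReal_pos.2 hψ).ne' ENNReal.ofReal_ne_top,
    ← ENNReal.ofReal_toReal f.2.ne, ← norm_def, ← ENNReal.ofReal_mul (norm_nonneg f)] at h_le

theorem norm_le_of_forall_rearrInt_le {f : Marcinkiewicz γ ψ} (hψ : ∀ t ∈ ioo γ, 0 < ψ t) {C : ℝ}
    (hC : 0 ≤ C) (hf : ∀ t ∈ ioo γ, rearrInt (leb γ) (f : L0 γ) t ≤ ENNReal.ofReal (C * ψ t)) :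
    ‖f‖ ≤ C := by
  refine ENNReal.toReal_le_of_le_ofReal hC (iSup₂_le fun t ht => ?_)
  rw [ENNReal.div_le_iff (ENNReal.ofReal_pos.2 (hψ t ht)).ne' ENNReal.ofReal_ne_top,
    ← ENNReal.ofReal_mul hC]
  exact hf t ht

theorem ae_eq_zero_or_eq_zero_of_inf_eq_zero {f g : L0 γ} (h : f ⊓ g = 0) :
    ∀ᵐ x ∂leb γ, f x = 0 ∨ g x = 0 := by
  filter_upwards [AEEqFun.coeFn_inf f g, AEEqFun.coeFn_zero (α := ℝ) (μ := leb γ) (β := ℝ)]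
    with x h_inf h_zero
  rw [h, h_zero] at h_inf
  exact (min_choice (f x) (g x)).imp (fun hf => hf.symm.trans h_inf.symm)
    fun hg => hg.symm.trans h_inf.symm

theorem norm_sum_le_of_disjoint {ι : Type*} {s : Finset ι} (hs : s.Nonempty)
    {g : ι → Marcinkiewicz γ ψ} (hg : ∀ i ∈ s, ‖g i‖ ≤ 1)
    (h_disj : (s : Set ι).Pairwise fun i j => g i ⊓ g j = 0) (hψ : ∀ t ∈ ioo γ, 0 < ψ t) {C : ℝ}
    (hC₀ : 0 ≤ C) (hC : ∀ t ∈ ioo γ,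
      ∑' k : ℕ, ENNReal.ofReal (ψ (t / (s.card * 2 ^ (k + 1)))) ≤ ENNReal.ofReal (C * ψ t)) :
    ‖∑ i ∈ s, g i‖ ≤ s.card * C := by
  have h_ae : ∀ᵐ x ∂leb γ, (s : Set ι).Pairwise fun i j =>
      (g i : L0 γ) x = 0 ∨ (g j : L0 γ) x = 0 := by
    simp only [Set.Pairwise, ae_ball_iff s.countable_toSet, eventually_imp_distrib_left]
    exact fun i hi j hj hij =>
      ae_eq_zero_or_eq_zero_of_inf_eq_zero (congrArg Subtype.val (h_disj hi hj hij))
  refine norm_le_of_forall_rearrInt_le hψ (by positivity) fun t ht => ?_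
  have h_card : (1 : ℝ) ≤ s.card := Nat.one_le_cast.2 hs.card_pos
  have h_unit (k : ℕ) (i : ι) (hi : i ∈ s) :
      rearrInt (leb γ) (g i : L0 γ) (t / (s.card * 2 ^ (k + 1))) ≤
        ENNReal.ofReal (ψ (t / (s.card * 2 ^ (k + 1)))) := by
    have hu : t / (s.card * 2 ^ (k + 1)) ∈ ioo γ :=
      div_mem_ioo ht (one_le_mul_of_one_le_of_one_le h_card (one_le_pow₀ one_le_two))
    refine (rearrInt_le_norm_mul hu (hψ _ hu)).trans (ENNReal.ofReal_le_ofReal ?_)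
    exact mul_le_of_le_one_left (hψ _ hu).le (hg i hi)
  have h_coe : ((∑ i ∈ s, g i : Marcinkiewicz γ ψ) : L0 γ) =ᵐ[leb γ]
      fun x => ∑ i ∈ s, (g i : L0 γ) x := by
    rw [Submodule.coe_sum]
    exact AEEqFun.coeFn_fun_finsetSum s _
  calc rearrInt (leb γ) ((∑ i ∈ s, g i : Marcinkiewicz γ ψ) : L0 γ) t
      ≤ rearrInt (leb γ) (fun x => ∑ i ∈ s, (g i : L0 γ) x) t :=
        rearrInt_mono (h_coe.mono fun x hx => (congrArg abs hx).le) t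
    _ ≤ s.card * ∑' k : ℕ, ENNReal.ofReal (ψ (t / (s.card * 2 ^ (k + 1)))) :=
        rearrInt_sum_le_of_disjoint hs h_ae ht.1 h_unit
    _ ≤ s.card * ENNReal.ofReal (C * ψ t) := by gcongr; exact hC t ht
    _ = ENNReal.ofReal (s.card * C * ψ t) := by
        rw [mul_assoc, ENNReal.ofReal_mul s.card.cast_nonneg, ENNReal.ofReal_natCast]

theorem HasGeometricDecay.hasSmallDisjointAverages (hψ : ∀ t ∈ ioo γ, 0 < ψ t)
    (h : HasGeometricDecay γ ψ) : HasSmallDisjointAverages (Marcinkiewicz γ ψ) := by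
  intro ε hε
  obtain ⟨N, hN⟩ := h.exists_tsum_ofReal_le (fun t ht => (hψ t ht).le) hε
  refine ⟨2 ^ N, by positivity, fun g _ hg h_disj => ?_⟩
  have h_card : (Finset.univ : Finset (Fin (2 ^ N))).card = 2 ^ N := by
    rw [Finset.card_univ, Fintype.card_fin]
  have h_norm := norm_sum_le_of_disjoint Finset.univ_nonempty (fun i _ => hg i)
    (fun i _ j _ hij => h_disj hij) hψ hε.le (by rw [h_card]; exact_mod_cast hN)
  rwa [h_card, mul_comm] at h_norm

end Space

end Marc

theorem proposition3_general (γ : ℝ≥0∞) (ψ : ℝ → ℝ) (hψ_mono : MonotoneOn ψ (Marc.ioo γ))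
    (hAB : Marc.ConditionA γ ψ ∨ Marc.ConditionB γ ψ) :
    Marc.HasOrderContinuousNorm (StrongDual ℝ (Marc.Marcinkiewicz γ ψ)) := by
  have hψ_pos : ∀ t ∈ Marc.ioo γ, 0 < ψ t := fun t ht =>
    Marc.pos_of_one_lt_liminf hψ_mono (hAB.elim (·.2.1) (·.2)) ht
  obtain ⟨q, hq, h_double⟩ := Marc.exists_eventually_le_mul hψ_pos hAB
  have h_decay : Marc.HasGeometricDecay γ ψ :=
    Marc.hasGeometricDecay_of_eventually_le_mul hψ_mono (fun t ht => (hψ_pos t ht).le) hq h_double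
  exact (h_decay.hasSmallDisjointAverages hψ_pos).hasOrderContinuousNorm_dual

theorem proposition3 (γ : ℝ≥0∞) (hγ : 0 < γ) (ψ : ℝ → ℝ)
    (hψ_nonneg : ∀ t ∈ Marc.ico γ, 0 ≤ ψ t)
    (hψ_ne : ∃ t ∈ Marc.ico γ, ψ t ≠ 0)
    (hψ_mono : MonotoneOn ψ (Marc.ico γ))
    (hψ_conc : ConcaveOn ℝ (Marc.ico γ) ψ)
    (hψ_cont : ContinuousOn ψ (Marc.ioo γ))
    (hψ_zero : ψ 0 = 0)
    (hAB : Marc.ConditionA γ ψ ∨ Marc.ConditionB γ ψ) :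
    Marc.HasOrderContinuousNorm (StrongDual ℝ (Marc.Marcinkiewicz γ ψ)) :=
  proposition3_general γ ψ (hψ_mono.mono Marc.ioo_subset_ico) hAB
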